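/- Let $F$ be a field (of any characteristic, not necessarily a splitting field), $G$ a finite group and $N$ a normal subgroup of $G$. Modules are left modules over group algebras over $F$. For an $F[N]$-module $W$ and $t\in G$, let $W^t$ be the conjugate module, that is, the vector space $W$ on which $n\in N$ acts as $t^{-1}nt$ acts on $W$. Let $V$ be a simple $F[N]$-module with inertia group $T_V=\{g\in G : V^g\cong V\}$, and let $P_V$ be its projective cover. Let $E$ be a simple $F[G]$-module with projective cover $P$. Fix a set of representatives of the left cosets of $T_V$ in $G$; "$t\in G/T_V$" means that $t$ runs over it. Suppose that $$E|_N\;\cong\; e\bigoplus_{t\in G/T_V}V^t$$ for some integer $e\ge 0$, where $e$ in front of a module denotes the direct sum of $e$ copies of it. Then there is an integer $a\ge 0$ such that $$P|_N\;\cong\; a\bigoplus_{t\in G/T_V}P_V^t .$$ Moreover, every such $a$ satisfies $a\ge e$, and $a=e$ if and only if $E$ is relatively $N$-projective, i.e. every short exact sequence $0\to K\to X\to E\to 0$ of $F[G]$-modules that splits over $F[N]$ splits over $F[G]$. -/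

import Mathlib

namespace CliffordCover

open Representation

/-- The restriction of a representation of `G` to a subgroup `N`. -/
abbrev res {F G E : Type*} [Field F] [Group G] [AddCommGroup E] [Module F E]
    (N : Subgroup G) (ρ : Representation F G E) : Representation F N E :=
  ρ.comp N.subtype

/-- The conjugate `V^t` of an `N`-module `V`, for `N` normal in `G` and `t : G`: the same vector
space, with `n : N` acting as `t⁻¹ n t` did. It is the `N`-module `t ⊗ V`, for which
`n (t ⊗ v) = t ⊗ (t⁻¹ n t) v`. -/
def conj {F G V : Type*} [Field F] [Group G] [AddCommGroup V] [Module F V]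
    {N : Subgroup G} [N.Normal] (ρ : Representation F N V) (t : G) : Representation F N V :=
  ρ.comp (MulAut.conjNormal t⁻¹ : MulAut N).toMonoidHom

theorem conj_one {F G V : Type*} [Field F] [Group G] [AddCommGroup V] [Module F V]
    {N : Subgroup G} [N.Normal] (ρ : Representation F N V) : conj ρ (1 : G) = ρ := by
  ext n v
  simp [conj]

theorem conj_conj {F G V : Type*} [Field F] [Group G] [AddCommGroup V] [Module F V]
    {N : Subgroup G} [N.Normal] (ρ : Representation F N V) (s t : G) :
    conj (conj ρ s) t = conj ρ (t * s) := by
  ext n v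
  simp [conj]

/-- An isomorphism of `N`-modules is also one of their conjugates. -/
def conjEquiv {F G V W : Type*} [Field F] [Group G] [AddCommGroup V] [Module F V]
    [AddCommGroup W] [Module F W] {N : Subgroup G} [N.Normal]
    {ρ : Representation F N V} {σ : Representation F N W} (φ : ρ.Equiv σ) (t : G) :
    (conj ρ t).Equiv (conj σ t) :=
  Representation.Equiv.mk φ.toLinearEquiv fun n => by
    ext v
    exact Representation.IntertwiningMap.isIntertwining ρ σ φ.toIntertwiningMap _ v

/-- The inertia group `T_V = {g : G | V^g ≅ V}` of an `N`-module `V`. -/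
def inertia {F G V : Type*} [Field F] [Group G] [AddCommGroup V] [Module F V]
    {N : Subgroup G} [N.Normal] (ρ : Representation F N V) : Subgroup G where
  carrier := {g | Nonempty ((conj ρ g).Equiv ρ)}
  one_mem' := by
    rw [Set.mem_ofPred_eq, conj_one]
    exact ⟨Representation.Equiv.refl ρ⟩
  mul_mem' := by
    rintro a b ⟨φ⟩ ⟨ψ⟩
    have h := conjEquiv ψ a
    rw [conj_conj] at h
    exact ⟨h.trans φ⟩
  inv_mem' := by
    rintro a ⟨φ⟩
    have h := conjEquiv φ a⁻¹
    rw [conj_conj, inv_mul_cancel, conj_one] at h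
    exact ⟨h.symm⟩

/-- The `N`-module `m ⨁_{q ∈ G/T} W^{r q}`: the direct sum, over the left cosets `q` of `T`, of `m`
copies of the conjugate of `W` by the element `r q`. -/
noncomputable abbrev conjSum {F G W : Type*} [Field F] [Group G] [AddCommGroup W] [Module F W]
    {N : Subgroup G} [N.Normal] (σ : Representation F N W) (T : Subgroup G) (r : G ⧸ T → G)
    (m : ℕ) : Representation F N (DirectSum (Fin m × (G ⧸ T)) fun _ => W) :=
  Representation.directSum fun i : Fin m × (G ⧸ T) => conj σ (r i.2)

/-- `π : P → M` is a projective cover: `P` is a projective `F[G]`-module and `π` is a surjective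
homomorphism of `G`-modules whose kernel is superfluous. -/
structure IsProjectiveCover {F G P M : Type*} [Field F] [Group G] [AddCommGroup P] [Module F P]
    [AddCommGroup M] [Module F M] {σ : Representation F G P} {ρ : Representation F G M}
    (π : IntertwiningMap σ ρ) : Prop where
  projective : Module.Projective (MonoidAlgebra F G) σ.asModule
  surjective : Function.Surjective π
  superfluous : ∀ U : Subrepresentation σ, U ⊔ π.ker = ⊤ → U = ⊤

universe u

/-- `M` is relatively `N`-projective: every homomorphism `π : X → M` of `G`-modules that splits
over `N` splits over `G`. (Such a `π` is surjective, so these are the short exact sequences of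
`G`-modules with third term `M`.) -/
def IsRelProjective {F G : Type*} {M : Type u} [Field F] [Group G] [AddCommGroup M] [Module F M]
    (N : Subgroup G) (ρ : Representation F G M) : Prop :=
  ∀ (X : Type u) [AddCommGroup X] [Module F X] (τ : Representation F G X)
    (π : IntertwiningMap τ ρ),
    (∃ s : IntertwiningMap (res N ρ) (res N τ), ∀ x, π (s x) = x) →
      ∃ s : IntertwiningMap ρ τ, ∀ x, π (s x) = x

end CliffordCover

namespace CliffordCover

open Representation
open scoped MonoidAlgebra

/-! ### Radicals, projective covers and isotypic components over a ring -/

section ModuleTheory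

variable {R : Type*} [Ring R]

/-! Let J be the radical of P|_N. It is G-stable, so M = P/J is a G-module (`headRes`), semisimple
over N, and P → E factors through a surjection ψ : M → E with superfluous kernel. In M|_N the sum of
the isotypic components of the V^t is G-stable and contains the image of an N-section of ψ; together
with ker ψ it spans M, hence it is M. As G permutes these components transitively, they share one
multiplicity a (`exists_equiv_conjSum`). Now P|_N is projective (`projective_res`) and maps onto
M|_N ≅ a ⨁ V^t with kernel J, so it is the projective cover a ⨁ P_V^t.

Dimensions determine a, and ψ gives e ≤ a, with equality exactly when ψ is injective, i.e. ker π =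
J. If E is relatively N-projective, ψ splits, because M|_N is semisimple, and superfluity makes the
section onto (`IsRelProjective.injective`). Conversely, given X → E with an N-section s, the
G-translates of s(E) span a G-submodule Y that is semisimple over N; a lift P → Y of π kills J = ker
π, so it descends to a G-section (`isRelProjective_of_ker_le`). -/

theorem ker_le_jacobson_of_superfluous {P M : Type*} [AddCommGroup P] [Module R P]
    [AddCommGroup M] [Module R M] (f : P →ₗ[R] M)
    (hf : ∀ U : Submodule R P, U ⊔ LinearMap.ker f = ⊤ → U = ⊤) :
    LinearMap.ker f ≤ Module.jacobson R P := by
  refine le_sInf fun m hm => ?_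
  by_contra hle
  refine hm.1 (hf m (hm.2 _ (lt_of_le_of_ne le_sup_left fun h => hle ?_)))
  rw [h]
  exact le_sup_right

/-- Nakayama: in a finitely generated module a proper submodule lies in a maximal one, which
contains the radical as well. -/
theorem eq_top_of_sup_eq_top_of_le_jacobson {P : Type*} [AddCommGroup P] [Module R P]
    [Module.Finite R P] {U K : Submodule R P} (hK : K ≤ Module.jacobson R P) (h : U ⊔ K = ⊤) :
    U = ⊤ := by
  obtain hU | ⟨m, hm, hUm⟩ := eq_top_or_exists_le_coatom U
  · exact hU
  · refine absurd ?_ hm.1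
    rw [eq_top_iff, ← h]
    exact sup_le hUm (hK.trans (sInf_le hm))

/-- A projective cover of a module is unique up to isomorphism. -/
theorem nonempty_linearEquiv_of_projective_of_ker_le_jacobson {P Q M : Type*}
    [AddCommGroup P] [Module R P] [AddCommGroup Q] [Module R Q] [AddCommGroup M] [Module R M]
    [Module.Projective R P] [Module.Projective R Q] [Module.Finite R P] [Module.Finite R Q]
    (f : P →ₗ[R] M) (g : Q →ₗ[R] M) (hf : Function.Surjective f) (hg : Function.Surjective g)
    (kf : LinearMap.ker f ≤ Module.jacobson R P) (kg : LinearMap.ker g ≤ Module.jacobson R Q) :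
    Nonempty (P ≃ₗ[R] Q) := by
  obtain ⟨h, hh⟩ := Module.projective_lifting_property g f hg
  have hsurj : Function.Surjective h := by
    rw [← LinearMap.range_eq_top]
    refine eq_top_of_sup_eq_top_of_le_jacobson kg (eq_top_iff.2 fun y _ => ?_)
    obtain ⟨x, hx⟩ := hf (g y)
    rw [← hh] at hx
    refine Submodule.mem_sup.2 ⟨h x, ⟨x, rfl⟩, y - h x, ?_, by abel⟩
    rw [LinearMap.mem_ker, map_sub, ← hx, LinearMap.comp_apply, sub_self]
  -- A section of `h` is again compatible with the maps to `M`, so it is onto by the same Nakayama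
  -- argument; a surjective section is an inverse.
  obtain ⟨k, hk⟩ := Module.projective_lifting_property h LinearMap.id hsurj
  have hfk : ∀ y, f (k y) = g y := fun y => by
    rw [← hh, LinearMap.comp_apply]
    exact congrArg g (LinearMap.congr_fun hk y)
  have ksurj : Function.Surjective k := by
    rw [← LinearMap.range_eq_top]
    refine eq_top_of_sup_eq_top_of_le_jacobson kf (eq_top_iff.2 fun x _ => ?_)
    obtain ⟨y, hy⟩ := hg (f x)
    refine Submodule.mem_sup.2 ⟨k y, ⟨y, rfl⟩, x - k y, ?_, by abel⟩
    rw [LinearMap.mem_ker, map_sub, hfk, hy, sub_self]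
  refine ⟨LinearEquiv.ofBijective h ⟨fun x x' hx => ?_, hsurj⟩⟩
  obtain ⟨y, rfl⟩ := ksurj x
  obtain ⟨y', rfl⟩ := ksurj x'
  have := LinearMap.congr_fun hk y
  have h' := LinearMap.congr_fun hk y'
  simp only [LinearMap.comp_apply, LinearMap.id_apply] at this h'
  rw [← this, hx, h']

/-- Each component of a kernel element lies in the radical of its summand, and homomorphisms carry
radicals into radicals. -/
theorem ker_lmap_le_jacobson {ι : Type*} {P M : ι → Type*}
    [∀ i, AddCommGroup (P i)] [∀ i, Module R (P i)] [∀ i, AddCommGroup (M i)]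
    [∀ i, Module R (M i)] (f : ∀ i, P i →ₗ[R] M i)
    (hf : ∀ i, LinearMap.ker (f i) ≤ Module.jacobson R (P i)) :
    LinearMap.ker (DirectSum.lmap f) ≤ Module.jacobson R (DirectSum ι P) := by
  classical
  intro x hx
  rw [← DirectSum.sum_support_of x]
  refine Submodule.sum_mem _ fun i _ => ?_
  refine Module.map_jacobson_le (DirectSum.lof R ι P i) (Submodule.mem_map_of_mem (hf i ?_))
  have := congrArg (fun y => y i) (LinearMap.mem_ker.1 hx)
  simpa [DirectSum.lmap_apply] using this

section Semilinear

variable {R' : Type*} [Ring R'] {σ : R →+* R'} {σ' : R' →+* R} [RingHomInvPair σ σ']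
  [RingHomInvPair σ' σ]

theorem map_isotypicComponent_le {M S M' S' : Type*} [AddCommGroup M] [Module R M]
    [AddCommGroup S] [Module R S] [AddCommGroup M'] [Module R' M'] [AddCommGroup S'] [Module R' S']
    (f : M ≃ₛₗ[σ] M') (h : S ≃ₛₗ[σ] S') :
    (isotypicComponent R M S).map f.toLinearMap ≤ isotypicComponent R' M' S' := by
  rw [Submodule.map_le_iff_le_comap]
  refine sSup_le ?_
  rintro m ⟨e⟩
  rw [← Submodule.map_le_iff_le_comap]
  exact le_sSup ⟨((f.submoduleMap m).symm.trans e).trans h⟩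

theorem map_isotypicComponent {M S M' S' : Type*} [AddCommGroup M] [Module R M]
    [AddCommGroup S] [Module R S] [AddCommGroup M'] [Module R' M'] [AddCommGroup S'] [Module R' S']
    (f : M ≃ₛₗ[σ] M') (h : S ≃ₛₗ[σ] S') :
    (isotypicComponent R M S).map f.toLinearMap = isotypicComponent R' M' S' := by
  refine le_antisymm (map_isotypicComponent_le f h) fun x hx => ?_
  exact ⟨f.symm x, map_isotypicComponent_le f.symm h.symm ⟨x, hx, rfl⟩, f.apply_symm_apply x⟩

end Semilinear

theorem range_le_isotypicComponent {S M : Type*} [AddCommGroup S] [Module R S] [IsSimpleModule R S]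
    [AddCommGroup M] [Module R M] (f : S →ₗ[R] M) :
    LinearMap.range f ≤ isotypicComponent R M S := by
  obtain h | rfl := f.injective_or_eq_zero
  · exact le_sSup ⟨(LinearEquiv.ofInjective f h).symm⟩
  · simp

/-- The isotypic components of pairwise non-isomorphic simple modules are independent. -/
theorem iSupIndep_isotypicComponent {ι M : Type*} {S : ι → Type*} [AddCommGroup M] [Module R M]
    [∀ i, AddCommGroup (S i)] [∀ i, Module R (S i)] [∀ i, IsSimpleModule R (S i)]
    (hS : ∀ i j, Nonempty (S i ≃ₗ[R] S j) → i = j) :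
    iSupIndep fun i => isotypicComponent R M (S i) := by
  intro i
  rw [disjoint_iff]
  by_contra hne
  have hss : IsSemisimpleModule R
      (isotypicComponent R M (S i) ⊓ ⨆ j, ⨆ (_ : j ≠ i), isotypicComponent R M (S j) :
        Submodule R M) :=
    .of_injective _ (Submodule.inclusion_injective inf_le_left)
  -- A simple submodule of the intersection is isomorphic to `S i`, and also to some `S j` with `j ≠
  -- i`.
  obtain ⟨T, hT, hTs⟩ := (IsSemisimpleModule.eq_bot_or_exists_simple_le _).resolve_left hne
  have hsup : (⨆ j, ⨆ (_ : j ≠ i), isotypicComponent R M (S j)) =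
      sSup {m | ∃ j, j ≠ i ∧ m = isotypicComponent R M (S j)} := by
    refine le_antisymm (iSup₂_le fun j hj => le_sSup ⟨j, hj, rfl⟩) (sSup_le ?_)
    rintro _ ⟨j, hj, rfl⟩
    exact le_iSup₂_of_le j hj le_rfl
  have (m : {m | ∃ j, j ≠ i ∧ m = isotypicComponent R M (S j)}) : IsSemisimpleModule R m := by
    obtain ⟨_, j, _, rfl⟩ := m
    infer_instance
  obtain ⟨_, ⟨j, hj, rfl⟩, T', hT', ⟨e⟩⟩ :=
    T.le_linearEquiv_of_le_sSup _ ((hT.trans inf_le_right).trans hsup.le)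
  have := IsSimpleModule.congr e.symm
  obtain ⟨e₁⟩ := isIsotypicOfType_submodule_iff.1 (.isotypicComponent R M (S i)) T
    (hT.trans inf_le_left)
  obtain ⟨e₂⟩ := isIsotypicOfType_submodule_iff.1 (.isotypicComponent R M (S j)) T' hT'
  exact hj (hS i j ⟨(e₁.symm.trans e).trans e₂⟩).symm

end ModuleTheory

/-! ### Representations as modules over the group algebra -/

section Bridges

variable {F G V W : Type*} [Field F] [Group G] [AddCommMonoid V] [Module F V]
  [AddCommMonoid W] [Module F W] {ρ : Representation F G V} {σ : Representation F G W}

/-- A homomorphism of representations as a homomorphism of modules over the group algebra. -/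
noncomputable abbrev asLinearMap (f : IntertwiningMap ρ σ) : ρ.asModule →ₗ[F[G]] σ.asModule :=
  IntertwiningMap.equivLinearMapAsModule ρ σ f

/-- An isomorphism of representations as an isomorphism of modules over the group algebra. -/
noncomputable def asLinearEquiv (φ : ρ.Equiv σ) : ρ.asModule ≃ₗ[F[G]] σ.asModule :=
  LinearEquiv.ofBijective (asLinearMap φ.toIntertwiningMap) φ.toLinearEquiv.bijective

theorem nonempty_equiv_iff :
    Nonempty (ρ.Equiv σ) ↔ Nonempty (ρ.asModule ≃ₗ[F[G]] σ.asModule) := by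
  refine ⟨fun ⟨φ⟩ => ⟨asLinearEquiv φ⟩, fun ⟨e⟩ => ?_⟩
  let f := (IntertwiningMap.equivLinearMapAsModule ρ σ).symm e.toLinearMap
  exact ⟨{ f with
    invFun := e.symm
    left_inv := e.symm_apply_apply
    right_inv := e.apply_symm_apply }⟩

/-- The direct sum of modules given by representations is the module of the direct sum of the
representations. -/
noncomputable def directSumAsModule {ι : Type*} {V : ι → Type*} [∀ i, AddCommMonoid (V i)]
    [∀ i, Module F (V i)] (ρ : ∀ i, Representation F G (V i)) :
    (DirectSum ι fun i => (ρ i).asModule) ≃ₗ[F[G]] (Representation.directSum ρ).asModule := by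
  classical
  let f : (DirectSum ι fun i => (ρ i).asModule) →ₗ[F[G]] (Representation.directSum ρ).asModule :=
    DirectSum.toModule F[G] ι _ fun i => asLinearMap
      ⟨DirectSum.lof F ι V i, fun g => by
        refine LinearMap.ext fun v => ?_
        exact (DirectSum.lmap_lof (fun i => ρ i g) i v).symm⟩
  refine LinearEquiv.ofBijective f ?_
  -- Both modules have the same underlying set, and `f` is the identity on it.
  have : ∀ x, f x = x := fun x => by
    induction x using DirectSum.induction_on with
    | zero => exact map_zero f
    | of i x => exact DirectSum.toModule_lof F[G] (M := fun i => (ρ i).asModule) i x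
    | add x y hx hy => exact (map_add f x y).trans (congrArg₂ (· + ·) hx hy)
  exact ⟨fun x y h => (this x).symm.trans (h.trans (this y)), fun y => ⟨y, this y⟩⟩

end Bridges

/-! ### Conjugation as semilinearity over F[N], and restriction of projectives -/

section Twist

variable {F G V W : Type*} [Field F] [Group G] [AddCommGroup V] [Module F V]
  [AddCommGroup W] [Module F W] {N : Subgroup G} [N.Normal]

/-- The automorphism of `F[N]` induced by conjugation by `t`. -/
noncomputable def conjAlg (F : Type*) [Field F] (N : Subgroup G) [N.Normal] (t : G) :
    F[N] ≃+* F[N] :=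
  MonoidAlgebra.mapDomainRingEquiv F (MulAut.conjNormal t : MulAut N)

attribute [local instance] RingHomInvPair.of_ringEquiv RingHomInvPair.of_ringEquiv_symm

/-- A linear equivalence that intertwines up to conjugation by `t` is semilinear over `F[N]`. -/
noncomputable def semilinearOfTwisted {ρ : Representation F N V} {σ : Representation F N W} (t : G)
    (f : V ≃ₗ[F] W) (hf : ∀ (n : N) (v : V), f (ρ n v) = σ (MulAut.conjNormal t n) (f v)) :
    ρ.asModule ≃ₛₗ[(conjAlg F N t : F[N] →+* F[N])] σ.asModule where
  toFun x := σ.asModuleEquiv.symm (f (ρ.asModuleEquiv x))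
  invFun x := ρ.asModuleEquiv.symm (f.symm (σ.asModuleEquiv x))
  left_inv x := f.symm_apply_apply x
  right_inv x := f.apply_symm_apply x
  map_add' x y := by simp only [map_add]
  map_smul' r x := by
    induction r using MonoidAlgebra.induction_linear with
    | zero => simp only [map_zero, zero_smul]
    | add a b ha hb => simp only [map_add, add_smul, ha, hb]
    | single n a =>
      have : (conjAlg F N t : F[N] →+* F[N]) (MonoidAlgebra.single n a) =
          MonoidAlgebra.single (MulAut.conjNormal t n) a := by
        simp [conjAlg]
      rw [this, Representation.single_smul, Representation.single_smul]
      exact (map_smul f a _).trans (congrArg (a • ·) (hf n x))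

/-- The identity of the space `V`, as a semilinear map to the conjugate module. -/
noncomputable def toConj (ρ : Representation F N V) (t : G) :
    ρ.asModule ≃ₛₗ[(conjAlg F N t : F[N] →+* F[N])] (conj ρ t).asModule :=
  semilinearOfTwisted t (LinearEquiv.refl F V) fun n v => by simp [conj]

/-- The action of `t : G` on a `G`-module, as a semilinear map of `N`-modules. -/
noncomputable def actSemilinear (ρ : Representation F G V) (t : G) :
    (res N ρ).asModule ≃ₛₗ[(conjAlg F N t : F[N] →+* F[N])] (res N ρ).asModule :=
  semilinearOfTwisted t
    { ρ t with
      invFun := ρ t⁻¹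
      left_inv := fun v => by simp
      right_inv := fun v => by simp } fun n v => by
    change ρ t (ρ n v) = ρ (MulAut.conjNormal t n : N) (ρ t v)
    rw [MulAut.conjNormal_apply, ← Module.End.mul_apply, ← Module.End.mul_apply, ← map_mul,
      ← map_mul, inv_mul_cancel_right]

instance (ρ : Representation F N V) [Module.Projective F[N] ρ.asModule] (t : G) :
    Module.Projective F[N] (conj ρ t).asModule :=
  Module.Projective.of_equiv (toConj ρ t)

instance (ρ : Representation F N V) [IsSimpleModule F[N] ρ.asModule] (t : G) :
    IsSimpleModule F[N] (conj ρ t).asModule :=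
  (isSimpleModule_iff _ _).2
    ((OrderIso.isSimpleOrder_iff (Submodule.orderIsoMapComap (toConj ρ t))).1 inferInstance)

/-- The identity is a semilinear bijection onto the conjugate module, so it transports the radical:
covers of V conjugate to covers of V^t. -/
theorem ker_conj_le_jacobson {ρ : Representation F N V} {σ : Representation F N W}
    (f : IntertwiningMap ρ σ) (hf : LinearMap.ker (asLinearMap f) ≤ Module.jacobson F[N] ρ.asModule)
    (t : G) (f' : IntertwiningMap (conj ρ t) (conj σ t)) (hf' : ∀ x, f' x = f x) :
    LinearMap.ker (asLinearMap f') ≤ Module.jacobson F[N] (conj ρ t).asModule := by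
  intro x hx
  rw [← Module.map_jacobson_of_bijective (f := (toConj ρ t).toLinearMap) (toConj ρ t).bijective]
  refine ⟨(toConj ρ t).symm x, hf ?_, (toConj ρ t).apply_symm_apply x⟩
  exact LinearMap.mem_ker.2 ((hf' x).symm.trans (LinearMap.mem_ker.1 hx))

theorem nonempty_conj_equiv_iff (ρ : Representation F N V) (s t : G) :
    Nonempty ((conj ρ s).Equiv (conj ρ t)) ↔
      (s : G ⧸ inertia ρ) = (t : G ⧸ inertia ρ) := by
  rw [eq_comm, QuotientGroup.eq]
  constructor
  · rintro ⟨φ⟩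
    have h := conjEquiv φ t⁻¹
    rw [conj_conj, conj_conj, inv_mul_cancel, conj_one] at h
    exact ⟨h⟩
  · rintro ⟨φ⟩
    have h := conjEquiv φ t
    rw [conj_conj, mul_inv_cancel_left] at h
    exact ⟨h⟩

/-- The `F[N]`-module underlying a projective `F[G]`-module is projective. -/
theorem projective_res {ρ : Representation F G V} (h : Module.Projective F[G] ρ.asModule) :
    Module.Projective F[N] (res N ρ).asModule := by
  obtain ⟨s, hs⟩ := h
  -- The factorization g = (g c(g)⁻¹) c(g) exhibits F[G] as a free left F[N]-module on coset
  -- representatives.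
  let c (g : G) : G := (QuotientGroup.mk g : G ⧸ N).out
  have hc (g : G) : g * (c g)⁻¹ ∈ N := by
    rw [Subgroup.Normal.mem_comm_iff inferInstance]
    exact QuotientGroup.eq.1 (QuotientGroup.out_eq' _)
  have hcn (n : N) (g : G) : c (n * g) = c g := by
    refine congrArg Quotient.out (QuotientGroup.eq.2 ?_)
    rw [mul_inv_rev, mul_assoc]
    exact (Subgroup.Normal.mem_comm_iff inferInstance).1 (by simp)
  let q (g : G) (p : ρ.asModule) : (res N ρ).asModule :=
    (res N ρ).asModuleEquiv.symm (ρ (c g) (ρ.asModuleEquiv p))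
  -- Moves g at p to g c(g)⁻¹ at c(g)p. This keeps the value of the linear combination and is
  -- N-equivariant, so composing it with the F[G]-section `s` yields an F[N]-section.
  let T : (ρ.asModule →₀ F[G]) →ₗ[F] ((res N ρ).asModule →₀ F[N]) :=
    Finsupp.lsum F fun p => (Finsupp.lsum F fun g =>
      (Finsupp.lsingle (q g p)).comp
        (MonoidAlgebra.lsingle (R := F) ⟨_, hc g⟩)).comp
        (MonoidAlgebra.coeffLinearEquiv F).toLinearMap
  have hT (p : ρ.asModule) (g : G) (a : F) : T (Finsupp.single p (MonoidAlgebra.single g a)) =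
      Finsupp.single (q g p)
        (MonoidAlgebra.single ⟨_, hc g⟩ a) := by
    simp only [T, Finsupp.lsum_single, LinearMap.comp_apply, LinearEquiv.coe_coe]
    rw [show MonoidAlgebra.coeffLinearEquiv F (MonoidAlgebra.single g a) = Finsupp.single g a from
      rfl, Finsupp.lsum_single]
    rfl
  have hTsmul (n : N) (a : F) (y : ρ.asModule →₀ F[G]) :
      T ((MonoidAlgebra.single (n : G) a : F[G]) • y) =
        (MonoidAlgebra.single n a : F[N]) • T y := by
    induction y using Finsupp.induction_linear with
    | zero => simp
    | add x y hx hy => rw [smul_add, map_add, map_add, smul_add, hx, hy]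
    | single p x =>
      induction x using MonoidAlgebra.induction_linear with
      | zero => simp
      | add x y hx hy => simp only [Finsupp.single_add, smul_add, map_add, hx, hy]
      | single g b =>
        rw [Finsupp.smul_single, smul_eq_mul, MonoidAlgebra.single_mul_single, hT, hT,
          Finsupp.smul_single, smul_eq_mul, MonoidAlgebra.single_mul_single]
        have hq : q (n * g) p = q g p := by simp only [q, hcn]
        have hn : (⟨_, hc (n * g)⟩ : N) = n * ⟨_, hc g⟩ :=
          Subtype.ext (by simp only [hcn, Subgroup.coe_mul, mul_assoc])
        rw [hq, hn]
  have hlin (y : ρ.asModule →₀ F[G]) :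
      (res N ρ).asModuleEquiv (Finsupp.linearCombination F[N] id (T y)) =
        ρ.asModuleEquiv (Finsupp.linearCombination F[G] id y) := by
    induction y using Finsupp.induction_linear with
    | zero => simp
    | add x y hx hy => simp only [map_add, hx, hy]
    | single p x =>
      induction x using MonoidAlgebra.induction_linear with
      | zero => simp
      | add x y hx hy => simp only [Finsupp.single_add, map_add, hx, hy]
      | single g b =>
        rw [hT, Finsupp.linearCombination_single, Finsupp.linearCombination_single,
          Representation.single_smul, Representation.single_smul]
        refine congrArg (fun v : V => b • v) ?_
        have (v : V) : ρ (g * (c g)⁻¹) (ρ (c g) v) = ρ g v := by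
          rw [← Module.End.mul_apply, ← map_mul, inv_mul_cancel_right]
        exact this _
  refine ⟨{
    toFun := fun v => T (s (ρ.asModuleEquiv.symm ((res N ρ).asModuleEquiv v)))
    map_add' := fun x y => by simp only [map_add]
    map_smul' := fun r x => ?_ }, fun v => ?_⟩
  · induction r using MonoidAlgebra.induction_linear with
    | zero => simp
    | add a b ha hb => rw [add_smul, map_add, map_add, map_add, map_add, ha, hb, map_add, add_smul]
    | single n a =>
      rw [RingHom.id_apply, ← hTsmul, ← map_smul]
      refine congrArg T (congrArg s ?_)
      rw [Representation.single_smul, Representation.single_smul]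
      rfl
  · exact (hlin _).trans (hs _)

end Twist

/-! ### Clifford theory for a module with superfluous map to E -/

section Clifford

variable {F G V E M : Type*} [Field F] [Group G] [AddCommGroup V] [Module F V]
  [AddCommGroup E] [Module F E] [AddCommGroup M] [Module F M] {N : Subgroup G} [N.Normal]

attribute [local instance] RingHomInvPair.of_ringEquiv RingHomInvPair.of_ringEquiv_symm

theorem map_isotypicComponent_actSemilinear (ρM : Representation F G M) (ρV : Representation F N V)
    (g s t : G) (h : ((g * s : G) : G ⧸ inertia ρV) = t) :
    (isotypicComponent F[N] (res N ρM).asModule (conj ρV s).asModule).map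
      (actSemilinear (N := N) ρM g).toLinearMap =
      isotypicComponent F[N] (res N ρM).asModule (conj ρV t).asModule := by
  obtain ⟨φ⟩ := (nonempty_conj_equiv_iff ρV (g * s) t).2 h
  rw [map_isotypicComponent (actSemilinear (N := N) ρM g) (toConj (conj ρV s) g)]
  have φ' : (conj (conj ρV s) g).Equiv (conj ρV t) := by
    rw [conj_conj]
    exact φ
  exact (asLinearEquiv φ').isotypicComponent_eq

/-- The action of ts⁻¹, only semilinear over F[N] but linear over F, carries one component onto the
other. -/
theorem finrank_isotypicComponent_eq (ρM : Representation F G M) (ρV : Representation F N V)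
    (s t : G) :
    Module.finrank F (isotypicComponent F[N] (res N ρM).asModule (conj ρV s).asModule) =
      Module.finrank F (isotypicComponent F[N] (res N ρM).asModule (conj ρV t).asModule) := by
  rw [← map_isotypicComponent_actSemilinear ρM ρV (t * s⁻¹) s t (by rw [inv_mul_cancel_right])]
  let f := (actSemilinear (N := N) ρM (t * s⁻¹)).submoduleMap
    (isotypicComponent F[N] (res N ρM).asModule (conj ρV s).asModule)
  exact LinearEquiv.finrank_eq
    { f with
      map_smul' := fun a x => Subtype.ext (map_smul (ρM (t * s⁻¹)) a
        ((res N ρM).asModuleEquiv x.1)) }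

/-- An N-section of `π` suffices: its image lies in the sum `W` of the components, and `W` is
G-stable, so superfluity over G applies to `W`. -/
theorem iSup_isotypicComponent_eq_top {ρM : Representation F G M} {ρE : Representation F G E}
    [IsSemisimpleModule F[N] (res N ρM).asModule] (π : IntertwiningMap ρM ρE)
    (hπ : Function.Surjective π)
    (hsup : ∀ U : Subrepresentation ρM, U ⊔ π.ker = ⊤ → U = ⊤)
    (ρV : Representation F N V) [IsSimpleModule F[N] ρV.asModule]
    (r : G ⧸ inertia ρV → G) (hr : ∀ q, (r q : G ⧸ inertia ρV) = q) (e : ℕ)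
    (he : Nonempty ((res N ρE).Equiv (conjSum ρV (inertia ρV) r e))) :
    ⨆ q, isotypicComponent F[N] (res N ρM).asModule (conj ρV (r q)).asModule = ⊤ := by
  set W := ⨆ q, isotypicComponent F[N] (res N ρM).asModule (conj ρV (r q)).asModule with hW
  have hWG (g : G) (x : (res N ρM).asModule) (hx : x ∈ W) : actSemilinear (N := N) ρM g x ∈ W := by
    have : W ≤ W.comap (actSemilinear (N := N) ρM g).toLinearMap := by
      conv_lhs => rw [hW]
      refine iSup_le fun q => ?_
      rw [← Submodule.map_le_iff_le_comap,
        map_isotypicComponent_actSemilinear ρM ρV g (r q) (r ((g * r q : G) : G ⧸ inertia ρV))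
          (hr _).symm]
      exact le_iSup (fun q => isotypicComponent F[N] (res N ρM).asModule (conj ρV (r q)).asModule) _
    exact this hx
  let U : Subrepresentation ρM := ⟨W.restrictScalars F, fun g v hv => hWG g v hv⟩
  suffices U = ⊤ from eq_top_iff.2 fun x _ => (show (x : M) ∈ U from this ▸ trivial)
  apply hsup
  obtain ⟨φ⟩ := he
  let ψ := (directSumAsModule fun i : Fin e × (G ⧸ inertia ρV) => conj ρV (r i.2)).trans
    (asLinearEquiv φ).symm
  let p : (res N ρM).asModule →ₗ[F[N]] (res N ρE).asModule :=
    asLinearMap (ρ := res N ρM) (σ := res N ρE) ⟨π.toLinearMap, fun n => π.isIntertwining' n⟩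
  have hp : Function.Surjective p := hπ
  obtain ⟨s, hs⟩ := IsSemisimpleModule.lifting_property p hp LinearMap.id
  have hsW (y : (res N ρE).asModule) : s y ∈ W := by
    obtain ⟨x, rfl⟩ := ψ.surjective y
    classical
    induction x using DirectSum.induction_on with
    | zero => rw [map_zero, map_zero]; exact W.zero_mem
    | of i x =>
      refine Submodule.mem_iSup_of_mem i.2 (range_le_isotypicComponent
        ((s.comp ψ.toLinearMap).comp (DirectSum.lof F[N] _ _ i)) ⟨x, rfl⟩)
    | add x y hx hy => rw [map_add, map_add]; exact W.add_mem hx hy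
  refine eq_top_iff.2 fun y _ => ?_
  let x : (res N ρM).asModule := y
  refine Submodule.mem_sup.2 ⟨s (p x), hsW _, x - s (p x), ?_, add_sub_cancel (s (p x)) x⟩
  change p (x - s (p x)) = 0
  rw [map_sub, sub_eq_zero]
  exact (LinearMap.congr_fun hs (p x)).symm

/-- If the restriction of a `G`-module `M` to `N` is semisimple, then it is a sum of copies of the
sum of the conjugates of `V` as soon as the same holds for a quotient of `M` by a superfluous
submodule. -/
theorem exists_equiv_conjSum [Finite G] [Module.Finite F M] [Module.Finite F V]
    {ρM : Representation F G M} {ρE : Representation F G E}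
    [IsSemisimpleModule F[N] (res N ρM).asModule] (π : IntertwiningMap ρM ρE)
    (hπ : Function.Surjective π)
    (hsup : ∀ U : Subrepresentation ρM, U ⊔ π.ker = ⊤ → U = ⊤)
    (ρV : Representation F N V) [IsSimpleModule F[N] ρV.asModule]
    (r : G ⧸ inertia ρV → G) (hr : ∀ q, (r q : G ⧸ inertia ρV) = q) (e : ℕ)
    (he : Nonempty ((res N ρE).Equiv (conjSum ρV (inertia ρV) r e))) :
    ∃ a : ℕ, Nonempty ((res N ρM).Equiv (conjSum ρV (inertia ρV) r a)) := by
  classical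
  have := Fintype.ofFinite (G ⧸ inertia ρV)
  have htop := iSup_isotypicComponent_eq_top π hπ hsup ρV r hr e he
  have hind : iSupIndep fun q =>
      isotypicComponent F[N] (res N ρM).asModule (conj ρV (r q)).asModule := by
    refine iSupIndep_isotypicComponent fun i j h => ?_
    rw [← hr i, ← hr j]
    exact (nonempty_conj_equiv_iff ρV _ _).1 (nonempty_equiv_iff.2 h)
  have hfin : Module.Finite F[N] (res N ρM).asModule := .of_restrictScalars_finite F _ _
  have hiso (q : G ⧸ inertia ρV) : ∃ n : ℕ, Nonempty
      (isotypicComponent F[N] (res N ρM).asModule (conj ρV (r q)).asModule ≃ₗ[F[N]]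
        (Fin n → (conj ρV (r q)).asModule)) :=
    (IsIsotypicOfType.isotypicComponent F[N] _ _).linearEquiv_fun
  choose n hn using hiso
  have hV : 0 < Module.finrank F V := by
    have : Nontrivial V := IsSimpleModule.nontrivial F[N] ρV.asModule
    exact Module.finrank_pos
  have hrank (q : G ⧸ inertia ρV) : Module.finrank F
      (isotypicComponent F[N] (res N ρM).asModule (conj ρV (r q)).asModule) =
      n q * Module.finrank F V := by
    obtain ⟨f⟩ := hn q
    rw [(f.restrictScalars F).finrank_eq, Module.finrank_pi_fintype, Finset.sum_const,
      Finset.card_univ, Fintype.card_fin, smul_eq_mul]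
    rfl
  -- Components of equal dimension have equal multiplicity, as all conjugates have the dimension of
  -- V, which is positive.
  have hconst (q : G ⧸ inertia ρV) : n q = n ((1 : G) : G ⧸ inertia ρV) := by
    have h := finrank_isotypicComponent_eq ρM ρV (r q) (r ((1 : G) : G ⧸ inertia ρV))
    rw [hrank, hrank] at h
    exact Nat.eq_of_mul_eq_mul_right hV h
  set a := n ((1 : G) : G ⧸ inertia ρV)
  have f (q : G ⧸ inertia ρV) :
      isotypicComponent F[N] (res N ρM).asModule (conj ρV (r q)).asModule ≃ₗ[F[N]]
        (Fin a → (conj ρV (r q)).asModule) :=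
    hconst q ▸ (hn q).some
  let f₁ : (res N ρM).asModule ≃ₗ[F[N]] DirectSum (G ⧸ inertia ρV) fun q =>
      isotypicComponent F[N] (res N ρM).asModule (conj ρV (r q)).asModule :=
    (hind.linearEquiv htop).symm
  let f₂ := DirectSum.linearEquivFunOnFintype F[N] (G ⧸ inertia ρV) fun q =>
    isotypicComponent F[N] (res N ρM).asModule (conj ρV (r q)).asModule
  let f₃ : (∀ q : G ⧸ inertia ρV, Fin a → (conj ρV (r q)).asModule) ≃ₗ[F[N]]
      ∀ i : Fin a × (G ⧸ inertia ρV), (conj ρV (r i.2)).asModule :=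
    { toFun := fun x i => x i.2 i.1
      invFun := fun x q i => x (i, q)
      map_add' := fun _ _ => rfl
      map_smul' := fun _ _ => rfl }
  let f₄ := DirectSum.linearEquivFunOnFintype F[N] (Fin a × (G ⧸ inertia ρV)) fun i =>
    (conj ρV (r i.2)).asModule
  exact ⟨a, nonempty_equiv_iff.2 ⟨f₁.trans (f₂.trans ((LinearEquiv.piCongrRight f).trans
    (f₃.trans (f₄.symm.trans (directSumAsModule fun i : Fin a × (G ⧸ inertia ρV) =>
      conj ρV (r i.2))))))⟩⟩

end Clifford

/-! ### Projective covers over the group algebra -/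

section Covers

variable {F G P M : Type*} [Field F] [Group G] [AddCommGroup P] [Module F P]
  [AddCommGroup M] [Module F M] {σ : Representation F G P} {ρ : Representation F G M}
  {π : IntertwiningMap σ ρ}

theorem IsProjectiveCover.eq_top_of_sup_ker_eq_top (hπ : IsProjectiveCover π)
    (U : Submodule F[G] σ.asModule) (h : U ⊔ LinearMap.ker (asLinearMap π) = ⊤) : U = ⊤ := by
  have hU := hπ.superfluous (Subrepresentation.ofSubmodule' U) <| eq_top_iff.2 fun x _ => by
    have hx : (σ.asModuleEquiv.symm x) ∈ U ⊔ LinearMap.ker (asLinearMap π) := h ▸ trivial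
    obtain ⟨y, hy, z, hz, e⟩ := Submodule.mem_sup.1 hx
    exact Submodule.mem_sup.2 ⟨y, hy, z, hz, e⟩
  exact eq_top_iff.2 fun x _ =>
    (show σ.asModuleEquiv x ∈ Subrepresentation.ofSubmodule' U from hU ▸ trivial)

theorem IsProjectiveCover.ker_le_jacobson (hπ : IsProjectiveCover π) :
    LinearMap.ker (asLinearMap π) ≤ Module.jacobson F[G] σ.asModule :=
  ker_le_jacobson_of_superfluous _ hπ.eq_top_of_sup_ker_eq_top

/-- The projective cover of a simple module is cyclic, hence finite dimensional. -/
theorem IsProjectiveCover.finite [Finite G] (hπ : IsProjectiveCover π) (hρ : ρ.IsIrreducible) :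
    Module.Finite F P := by
  have : Nontrivial M := IsSimpleModule.nontrivial F[G] ρ.asModule
  obtain ⟨y, hy⟩ := exists_ne (0 : M)
  obtain ⟨x, rfl⟩ := hπ.surjective y
  let x' : σ.asModule := x
  -- By simplicity any `x` with nonzero image generates a submodule mapping onto `M`; with the
  -- superfluous kernel it spans everything.
  have hx : Submodule.span F[G] {x'} = ⊤ := by
    apply hπ.eq_top_of_sup_ker_eq_top
    rw [← Submodule.comap_map_eq]
    have := (eq_bot_or_eq_top ((Submodule.span F[G] {x'}).map (asLinearMap π))).resolve_left
      fun h => hy ((Submodule.eq_bot_iff _).1 h _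
        (Submodule.mem_map_of_mem (Submodule.mem_span_singleton_self x')))
    rw [this, Submodule.comap_top]
  have h₁ : Module.Finite F[G] σ.asModule := ⟨⟨{x'}, by rw [Finset.coe_singleton, hx]⟩⟩
  have h₂ : Module.Finite F F[G] := inferInstance
  have h₃ : Module.Finite F σ.asModule := .trans F[G] _
  exact h₃

end Covers

/-! ### Relative projectivity and the radical of the restriction -/

section RelProjective

universe u

variable {F G P M : Type*} {E : Type u} [Field F] [Group G] [AddCommGroup P] [Module F P]
  [AddCommGroup M] [Module F M] [AddCommGroup E] [Module F E] {N : Subgroup G}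

/-- The restriction of a homomorphism of `G`-modules to `N`. -/
def resMap {σ : Representation F G P} {ρ : Representation F G M} (N : Subgroup G)
    (f : IntertwiningMap σ ρ) : IntertwiningMap (res N σ) (res N ρ) :=
  ⟨f.toLinearMap, fun n => f.isIntertwining' n⟩

/-- A homomorphism to a `G`-module that is semisimple over `N` kills the radical of the restriction
to `N`. -/
theorem apply_eq_zero_of_mem_jacobson {ρP : Representation F G P} {ρE : Representation F G E}
    [IsSemisimpleModule F[N] (res N ρE).asModule] (π : IntertwiningMap ρP ρE) {x : P}
    (hx : x ∈ Module.jacobson F[N] (res N ρP).asModule) : π x = 0 := by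
  have := Module.map_jacobson_le (asLinearMap (resMap N π)) ⟨x, hx, rfl⟩
  rw [IsSemisimpleModule.jacobson_eq_bot] at this
  exact this

/-- A surjection onto a relatively `N`-projective module whose source is semisimple over `N`
splits. -/
theorem IsRelProjective.exists_section [Module.Finite F M] [Nontrivial E]
    {ρE : Representation F G E} (h : IsRelProjective N ρE) {ρM : Representation F G M}
    [IsSemisimpleModule F[N] (res N ρM).asModule] (π : IntertwiningMap ρM ρE)
    (hπ : Function.Surjective π) : ∃ s : IntertwiningMap ρE ρM, ∀ x, π (s x) = x := by
  -- Relative projectivity tests only modules in the universe of `E`. Since F embeds in `E` and `M`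
  -- is finite dimensional, `M` has a copy there.
  have : Small.{u} F := by
    obtain ⟨x, hx⟩ := exists_ne (0 : E)
    exact small_of_injective (smul_left_injective F hx)
  have : Small.{u} M :=
    small_of_injective (Module.finBasis F M).equivFun.injective
  let e : Shrink.{u} M ≃ₗ[F] M := Shrink.linearEquiv F M
  let τ : Representation F G (Shrink.{u} M) :=
    { toFun := fun g => e.symm.toLinearMap ∘ₗ ρM g ∘ₗ e.toLinearMap
      map_one' := by ext; simp
      map_mul' := fun g h => by ext; simp }
  let i : IntertwiningMap τ ρM := ⟨e.toLinearMap, fun g => by ext; simp [τ]⟩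
  let j : IntertwiningMap ρM τ := ⟨e.symm.toLinearMap, fun g => by ext; simp [τ]⟩
  have hij (x : M) : i (j x) = x := e.apply_symm_apply x
  obtain ⟨s, hs⟩ := IsSemisimpleModule.lifting_property (asLinearMap (resMap N π)) hπ
    LinearMap.id
  let s' : IntertwiningMap (res N ρE) (res N ρM) :=
    (IntertwiningMap.equivLinearMapAsModule _ _).symm s
  have hs' (x : E) : π (s' x) = x := LinearMap.congr_fun hs x
  obtain ⟨t, ht⟩ := h (Shrink.{u} M) τ (π.comp i) ⟨(resMap N j).comp s', fun x => by
    exact (congrArg π (hij _)).trans (hs' x)⟩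
  exact ⟨i.comp t, ht⟩

/-- The image of a section complements the superfluous kernel, so the section is onto and inverts
`π`. -/
theorem IsRelProjective.injective [Module.Finite F M] [Nontrivial E]
    {ρE : Representation F G E} (h : IsRelProjective N ρE) {ρM : Representation F G M}
    [IsSemisimpleModule F[N] (res N ρM).asModule] (π : IntertwiningMap ρM ρE)
    (hπ : Function.Surjective π) (hsup : ∀ U : Subrepresentation ρM, U ⊔ π.ker = ⊤ → U = ⊤) :
    Function.Injective π := by
  obtain ⟨s, hs⟩ := h.exists_section π hπ
  have : s.range = ⊤ := by
    refine hsup _ (eq_top_iff.2 fun x _ => ?_)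
    refine Submodule.mem_sup.2 ⟨s (π x), ⟨π x, rfl⟩, x - s (π x), ?_, add_sub_cancel _ _⟩
    change π (x - s (π x)) = 0
    rw [map_sub, hs, sub_self]
  have hsurj (x : M) : ∃ y, s y = x := show x ∈ s.range from this ▸ trivial
  intro x y hxy
  obtain ⟨x, rfl⟩ := hsurj x
  obtain ⟨y, rfl⟩ := hsurj y
  rw [hs, hs] at hxy
  rw [hxy]

/-- If `E` is semisimple over `N`, then an `N`-section of `π : X → E` has its image in a
`G`-submodule of `X` that is semisimple over `N`. -/
theorem exists_subrepresentation_isSemisimpleModule [N.Normal] {X : Type*} [AddCommGroup X]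
    [Module F X]
    {ρE : Representation F G E} [IsSemisimpleModule F[N] (res N ρE).asModule]
    {τ : Representation F G X} (s : IntertwiningMap (res N ρE) (res N τ)) :
    ∃ Y : Subrepresentation τ, (∀ x, s x ∈ Y) ∧
      IsSemisimpleModule F[N] (res N Y.toRepresentation).asModule := by
  -- The translate g s g⁻¹ is again N-linear because N is normal. The images of all translates span
  -- the required submodule.
  let sg (g : G) : (res N ρE).asModule →ₗ[F[N]] (res N τ).asModule :=
    asLinearMap ⟨τ g ∘ₗ s.toLinearMap ∘ₗ ρE g⁻¹, fun n => by
      refine LinearMap.ext fun x => ?_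
      have h₁ : ρE g⁻¹ (ρE n x) = res N ρE (MulAut.conjNormal g⁻¹ n) (ρE g⁻¹ x) := by
        change _ = ρE (MulAut.conjNormal g⁻¹ n : N) (ρE g⁻¹ x)
        rw [MulAut.conjNormal_apply, ← Module.End.mul_apply, ← Module.End.mul_apply, ← map_mul,
          ← map_mul]
        simp
      have h₂ (y : X) : τ g (res N τ (MulAut.conjNormal g⁻¹ n) y) = τ n (τ g y) := by
        change τ g (τ (MulAut.conjNormal g⁻¹ n : N) y) = _
        rw [MulAut.conjNormal_apply, ← Module.End.mul_apply, ← Module.End.mul_apply, ← map_mul,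
          ← map_mul]
        simp [mul_assoc]
      change τ g (s (ρE g⁻¹ (ρE n x))) = τ n (τ g (s (ρE g⁻¹ x)))
      rw [h₁, s.isIntertwining, h₂]⟩
  let W : Submodule F[N] (res N τ).asModule := ⨆ g, LinearMap.range (sg g)
  have hW : IsSemisimpleModule F[N] W := by
    change IsSemisimpleModule F[N] (⨆ g, LinearMap.range (sg g) : Submodule _ _)
    rw [← iSup_univ]
    exact isSemisimpleModule_biSup_of_isSemisimpleModule_submodule fun g _ => .range _
  have hstab (h : G) (x : (res N τ).asModule) (hx : x ∈ W) :
      (res N τ).asModuleEquiv.symm (τ h ((res N τ).asModuleEquiv x)) ∈ W := by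
    refine Submodule.iSup_induction (fun g => LinearMap.range (sg g))
      (motive := fun y => (res N τ).asModuleEquiv.symm (τ h ((res N τ).asModuleEquiv y)) ∈ W)
      hx ?_ ?_ ?_
    · rintro g _ ⟨y, rfl⟩
      refine Submodule.mem_iSup_of_mem (h * g) ⟨ρE h y, ?_⟩
      have hh (y : E) : τ (h * g) (s (ρE (h * g)⁻¹ (ρE h y))) = τ h (τ g (s (ρE g⁻¹ y))) := by
        simp [← Module.End.mul_apply, ← map_mul]
      exact hh y
    · simp only [map_zero, W.zero_mem]
    · intro x y hx hy
      simp only [map_add]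
      exact W.add_mem hx hy
  let Y : Subrepresentation τ := ⟨W.restrictScalars F, hstab⟩
  refine ⟨Y, fun x => Submodule.mem_iSup_of_mem (p := fun g => LinearMap.range (sg g)) (1 : G)
    ⟨x, ?_⟩, ?_⟩
  · have h₁ (x : E) : τ 1 (s (ρE (1 : G)⁻¹ x)) = s x := by simp
    exact h₁ x
  · let i : (res N Y.toRepresentation).asModule →ₗ[F[N]] (res N τ).asModule :=
      asLinearMap ⟨Y.toSubmodule.subtype, fun _ => rfl⟩
    let i' : (res N Y.toRepresentation).asModule →ₗ[F[N]] W := i.codRestrict W fun x => x.2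
    exact .of_injective i' fun x y h => Subtype.ext (congrArg Subtype.val h)

/-- If the kernel of the projective cover of `E` is contained in the radical of the restriction to
`N`, then `E` is relatively `N`-projective. -/
theorem isRelProjective_of_ker_le [N.Normal] {ρE : Representation F G E}
    [IsSemisimpleModule F[N] (res N ρE).asModule]
    {ρP : Representation F G P} {π : IntertwiningMap ρP ρE} (hπ : IsProjectiveCover π)
    (hker : ∀ x : P, π x = 0 → x ∈ Module.jacobson F[N] (res N ρP).asModule) :
    IsRelProjective N ρE := by
  intro X _ _ τ p ⟨s, hs⟩
  obtain ⟨Y, hY, hYss⟩ := exists_subrepresentation_isSemisimpleModule s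
  let i : IntertwiningMap Y.toRepresentation τ := ⟨Y.toSubmodule.subtype, fun _ => rfl⟩
  have := hπ.projective
  obtain ⟨f, hf⟩ := Module.projective_lifting_property (asLinearMap (p.comp i)) (asLinearMap π)
    fun x => ⟨⟨s x, hY x⟩, hs x⟩
  let f' : IntertwiningMap ρP Y.toRepresentation :=
    (IntertwiningMap.equivLinearMapAsModule _ _).symm f
  have hf' (x : P) : p (i (f' x)) = π x := LinearMap.congr_fun hf x
  -- `Y` is semisimple over N, so the lift kills the radical, hence ker π, and descends along `π` to
  -- `E`.
  have hf0 (x : P) (hx : π x = 0) : f' x = 0 :=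
    apply_eq_zero_of_mem_jacobson f' (hker x hx)
  choose c hc using hπ.surjective
  have hfc (x : P) : f' (c (π x)) = f' x := by
    rw [← sub_eq_zero, ← map_sub]
    exact hf0 _ (by rw [map_sub, hc, sub_self])
  let t : IntertwiningMap ρE Y.toRepresentation :=
    { toFun := fun x => f' (c x)
      map_add' := fun x y => by
        rw [← hc x, ← hc y, ← map_add, hfc, hfc, hfc, map_add]
      map_smul' := fun a x => by
        rw [← hc x, ← map_smul, hfc, hfc, map_smul, RingHom.id_apply]
      isIntertwining' := fun g => by
        refine LinearMap.ext fun x => ?_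
        change f' (c (ρE g x)) = Y.toRepresentation g (f' (c x))
        obtain ⟨y, rfl⟩ := hπ.surjective x
        rw [← π.isIntertwining, hfc, hfc, f'.isIntertwining] }
  refine ⟨i.comp t, fun x => ?_⟩
  exact (hf' (c x)).trans (hc x)

end RelProjective

/-! ### The quotient P/rad(P|_N) as a G-module -/

section Head

variable {F G P E : Type*} [Field F] [Group G] [AddCommGroup P] [Module F P]
  [AddCommGroup E] [Module F E] {N : Subgroup G} [N.Normal]

attribute [local instance] RingHomInvPair.of_ringEquiv RingHomInvPair.of_ringEquiv_symm

/-- Elements of G act by semilinear automorphisms over F[N], and these preserve the radical. -/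
theorem apply_mem_jacobson_res (N : Subgroup G) [N.Normal] (ρ : Representation F G P) (g : G)
    (x : P) (hx : x ∈ (Module.jacobson F[N] (res N ρ).asModule).restrictScalars F) :
    ρ g x ∈ (Module.jacobson F[N] (res N ρ).asModule).restrictScalars F :=
  Module.map_jacobson_le (actSemilinear (N := N) ρ g).toLinearMap ⟨x, hx, rfl⟩

/-- The largest quotient of a `G`-module that is semisimple over `N`, for `P` finite dimensional: the quotient
by the radical of its restriction to `N`. -/
noncomputable abbrev headRes (N : Subgroup G) [N.Normal] (ρ : Representation F G P) :
    Representation F G (P ⧸ (Module.jacobson F[N] (res N ρ).asModule).restrictScalars F) :=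
  ρ.quotient _ fun g => apply_mem_jacobson_res N ρ g

/-- The quotient map to `headRes`. -/
noncomputable def toHeadRes (N : Subgroup G) [N.Normal] (ρ : Representation F G P) :
    IntertwiningMap ρ (headRes N ρ) :=
  ⟨Submodule.mkQ _, fun _ => rfl⟩

theorem toHeadRes_surjective (ρ : Representation F G P) : Function.Surjective (toHeadRes N ρ) :=
  Submodule.mkQ_surjective _

theorem toHeadRes_eq_zero_iff (ρ : Representation F G P) (x : P) :
    toHeadRes N ρ x = 0 ↔ x ∈ Module.jacobson F[N] (res N ρ).asModule :=
  Submodule.Quotient.mk_eq_zero _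

theorem ker_resMap_toHeadRes_le (ρ : Representation F G P) :
    LinearMap.ker (asLinearMap (resMap N (toHeadRes N ρ))) ≤
      Module.jacobson F[N] (res N ρ).asModule :=
  fun _ hx => (toHeadRes_eq_zero_iff ρ _).1 (LinearMap.mem_ker.1 hx)

/-- Finite dimension makes the quotient Artinian, where semisimple means zero radical; dividing by
the radical achieves that. -/
theorem isSemisimpleModule_headRes [Module.Finite F P] (ρ : Representation F G P) :
    IsSemisimpleModule F[N] (res N (headRes N ρ)).asModule := by
  have : IsArtinian F[N] (res N (headRes N ρ)).asModule := isArtinian_of_tower F inferInstance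
  rw [IsArtinian.isSemisimpleModule_iff_jacobson, ← Module.map_jacobson_of_ker_le
    (f := asLinearMap (resMap N (toHeadRes N ρ))) (toHeadRes_surjective ρ)
    (ker_resMap_toHeadRes_le ρ), eq_bot_iff]
  rintro _ ⟨_, hx, rfl⟩
  exact (toHeadRes_eq_zero_iff ρ _).2 hx

/-- A homomorphism to a `G`-module that is semisimple over `N` factors through `headRes`. -/
noncomputable def headResLift {ρP : Representation F G P} {ρE : Representation F G E}
    [IsSemisimpleModule F[N] (res N ρE).asModule] (π : IntertwiningMap ρP ρE) :
    IntertwiningMap (headRes N ρP) ρE :=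
  ⟨Submodule.liftQ _ π.toLinearMap fun _ hx => apply_eq_zero_of_mem_jacobson π hx, fun g => by
    refine LinearMap.ext fun x => ?_
    obtain ⟨x, rfl⟩ := Submodule.mkQ_surjective _ x
    exact IntertwiningMap.isIntertwining _ _ π g x⟩

theorem headResLift_toHeadRes {ρP : Representation F G P} {ρE : Representation F G E}
    [IsSemisimpleModule F[N] (res N ρE).asModule] (π : IntertwiningMap ρP ρE) (x : P) :
    headResLift (N := N) π (toHeadRes N ρP x) = π x :=
  rfl

/-- The preimage of `U` in P, together with ker π, is all of P, so superfluity descends to the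
quotient. -/
theorem headResLift_superfluous {ρP : Representation F G P} {ρE : Representation F G E}
    [IsSemisimpleModule F[N] (res N ρE).asModule] {π : IntertwiningMap ρP ρE}
    (hπ : IsProjectiveCover π) (U : Subrepresentation (headRes N ρP))
    (hU : U ⊔ (headResLift (N := N) π).ker = ⊤) : U = ⊤ := by
  let U' : Subrepresentation ρP :=
    ⟨U.toSubmodule.comap (toHeadRes N ρP).toLinearMap, fun g x hx => by
      have := U.apply_mem_toSubmodule g hx
      exact this⟩
  have h : U' = ⊤ := hπ.superfluous U' <| eq_top_iff.2 fun x _ => by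
    have hx : toHeadRes N ρP x ∈ U ⊔ (headResLift (N := N) π).ker := hU ▸ trivial
    obtain ⟨y, hy, z, hz, e⟩ := Submodule.mem_sup.1 hx
    obtain ⟨y, rfl⟩ := toHeadRes_surjective ρP y
    refine Submodule.mem_sup.2 ⟨y, hy, x - y, ?_, add_sub_cancel _ _⟩
    have hz' : headResLift (N := N) π z = 0 := hz
    rw [eq_sub_of_add_eq' e, ← map_sub, headResLift_toHeadRes] at hz'
    exact hz'
  refine eq_top_iff.2 fun x _ => ?_
  obtain ⟨x, rfl⟩ := toHeadRes_surjective ρP x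
  exact show x ∈ U' from h ▸ trivial

end Head

/-! ### Sums of conjugates and their projective covers -/

section ConjSum

variable {F G V PV : Type*} [Field F] [Group G] [AddCommGroup V] [Module F V]
  [AddCommGroup PV] [Module F PV] {N : Subgroup G} [N.Normal]

theorem isSemisimpleModule_conjSum (ρ : Representation F N V) [IsSimpleModule F[N] ρ.asModule]
    (T : Subgroup G) (r : G ⧸ T → G) (m : ℕ) :
    IsSemisimpleModule F[N] (conjSum ρ T r m).asModule :=
  have : IsSemisimpleModule F[N] (DirectSum (Fin m × (G ⧸ T)) fun i =>
      (conj ρ (r i.2)).asModule) :=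
    inferInstanceAs (IsSemisimpleModule F[N] (Π₀ i : Fin m × (G ⧸ T), (conj ρ (r i.2)).asModule))
  .congr (directSumAsModule fun i : Fin m × (G ⧸ T) => conj ρ (r i.2)).symm

theorem finrank_conjSum [Finite G] [Module.Finite F V] (T : Subgroup G) (m : ℕ) :
    Module.finrank F (DirectSum (Fin m × (G ⧸ T)) fun _ => V) =
      m * (Nat.card (G ⧸ T) * Module.finrank F V) := by
  classical
  have := Fintype.ofFinite (G ⧸ T)
  rw [Module.finrank_directSum, Finset.sum_const, Finset.card_univ, Fintype.card_prod,
    Fintype.card_fin, smul_eq_mul, Nat.card_eq_fintype_card, mul_assoc]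

/-- A module with a projective cover-like surjection from a projective module onto
`m ⨁ V^t` is isomorphic to `m ⨁ P_V^t`. -/
theorem nonempty_linearEquiv_conjSum [Finite G] {X : Type*} [AddCommGroup X] [Module F[N] X]
    [Module.Projective F[N] X] [Module.Finite F[N] X] [Module.Finite F PV]
    {ρPV : Representation F N PV} {ρV : Representation F N V} {πV : IntertwiningMap ρPV ρV}
    (hπV : IsProjectiveCover πV) (T : Subgroup G) (r : G ⧸ T → G) (m : ℕ)
    (f : X →ₗ[F[N]] (DirectSum (Fin m × (G ⧸ T)) fun i => (conj ρV (r i.2)).asModule))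
    (hf : Function.Surjective f) (kf : LinearMap.ker f ≤ Module.jacobson F[N] X) :
    Nonempty (X ≃ₗ[F[N]] DirectSum (Fin m × (G ⧸ T)) fun i => (conj ρPV (r i.2)).asModule) := by
  have := hπV.projective
  have (i : Fin m × (G ⧸ T)) : Module.Finite F[N] (conj ρPV (r i.2)).asModule :=
    .of_restrictScalars_finite F _ _
  let c (t : G) : IntertwiningMap (conj ρPV t) (conj ρV t) :=
    ⟨πV.toLinearMap, fun _ => πV.isIntertwining' _⟩
  refine nonempty_linearEquiv_of_projective_of_ker_le_jacobson f
    (DirectSum.lmap fun i : Fin m × (G ⧸ T) => asLinearMap (c (r i.2))) hf ?_ kf ?_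
  · exact (DirectSum.lmap_surjective _).2 fun i => hπV.surjective
  · exact ker_lmap_le_jacobson _ fun i =>
      ker_conj_le_jacobson πV hπV.ker_le_jacobson _ _ fun _ => rfl

end ConjSum

end CliffordCover

/-! ### The main theorem -/

theorem theorem6p1 {F G E P V PV : Type*} [Field F] [Group G] [Finite G]
    (N : Subgroup G) [N.Normal]
    [AddCommGroup E] [Module F E] [AddCommGroup P] [Module F P]
    [AddCommGroup V] [Module F V] [AddCommGroup PV] [Module F PV]
    -- the simple `G`-module `E`, with a projective cover `P`
    (ρE : Representation F G E) (hE : ρE.IsIrreducible)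
    (ρP : Representation F G P) (π : Representation.IntertwiningMap ρP ρE)
    (hπ : CliffordCover.IsProjectiveCover π)
    -- the simple `N`-module `V`, with a projective cover `PV`
    (ρV : Representation F N V) (hV : ρV.IsIrreducible)
    (ρPV : Representation F N PV) (πV : Representation.IntertwiningMap ρPV ρV)
    (hπV : CliffordCover.IsProjectiveCover πV)
    -- representatives of the left cosets of the inertia group
    (r : G ⧸ CliffordCover.inertia ρV → G) (hr : ∀ q, (r q : G ⧸ CliffordCover.inertia ρV) = q)
    -- the decomposition of the restriction of `E` to `N`
    (e : ℕ)
    (he : Nonempty ((CliffordCover.res N ρE).Equiv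
      (CliffordCover.conjSum ρV (CliffordCover.inertia ρV) r e))) :
    (∃ a : ℕ, Nonempty ((CliffordCover.res N ρP).Equiv
      (CliffordCover.conjSum ρPV (CliffordCover.inertia ρV) r a))) ∧
    ∀ a : ℕ, Nonempty ((CliffordCover.res N ρP).Equiv
      (CliffordCover.conjSum ρPV (CliffordCover.inertia ρV) r a)) →
      e ≤ a ∧ (a = e ↔ CliffordCover.IsRelProjective N ρE) := by
  have hE' := (Representation.irreducible_iff_isSimpleModule_asModule ρE).1 hE
  have hV' := (Representation.irreducible_iff_isSimpleModule_asModule ρV).1 hV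
  have : Nontrivial E := IsSimpleModule.nontrivial (MonoidAlgebra F G) ρE.asModule
  have hPfin := hπ.finite hE
  have hPVfin := hπV.finite hV
  have hVfin : Module.Finite F V := .of_surjective πV.toLinearMap hπV.surjective
  have hss : IsSemisimpleModule (MonoidAlgebra F N) (CliffordCover.res N ρE).asModule := by
    have := CliffordCover.isSemisimpleModule_conjSum ρV (CliffordCover.inertia ρV) r e
    exact .congr (CliffordCover.asLinearEquiv he.some)
  have hMss := CliffordCover.isSemisimpleModule_headRes (N := N) ρP
  let ψ := CliffordCover.headResLift (N := N) π
  have hψ : Function.Surjective ψ := fun y => by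
    obtain ⟨x, rfl⟩ := hπ.surjective y
    exact ⟨CliffordCover.toHeadRes N ρP x, rfl⟩
  have hψsup := CliffordCover.headResLift_superfluous (N := N) hπ
  -- The multiplicity is that of V in P/rad(P|_N).
  obtain ⟨a, ⟨φ⟩⟩ := CliffordCover.exists_equiv_conjSum ψ hψ hψsup ρV r hr e he
  have hXproj := CliffordCover.projective_res (N := N) hπ.projective
  have hXfin : Module.Finite (MonoidAlgebra F N) (CliffordCover.res N ρP).asModule :=
    .of_restrictScalars_finite F _ _
  let D := CliffordCover.directSumAsModule
    fun i : Fin a × (G ⧸ CliffordCover.inertia ρV) => CliffordCover.conj ρV (r i.2)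
  let D' := CliffordCover.directSumAsModule
    fun i : Fin a × (G ⧸ CliffordCover.inertia ρV) => CliffordCover.conj ρPV (r i.2)
  let p := CliffordCover.asLinearMap (CliffordCover.resMap N (CliffordCover.toHeadRes N ρP))
  let d := (CliffordCover.asLinearEquiv φ).trans D.symm
  obtain ⟨χ⟩ := CliffordCover.nonempty_linearEquiv_conjSum hπV (CliffordCover.inertia ρV) r a
    (d.toLinearMap.comp p)
    (d.surjective.comp (CliffordCover.toHeadRes_surjective (N := N) ρP)) (by
      rw [LinearEquiv.ker_comp]
      exact CliffordCover.ker_resMap_toHeadRes_le ρP)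
  have ha : Nonempty ((CliffordCover.res N ρP).Equiv
      (CliffordCover.conjSum ρPV (CliffordCover.inertia ρV) r a)) :=
    CliffordCover.nonempty_equiv_iff.2 ⟨χ.trans D'⟩
  have hcard : 0 < Nat.card (G ⧸ CliffordCover.inertia ρV) := Nat.card_pos
  have hV0 : 0 < Module.finrank F V := by
    have : Nontrivial V := IsSimpleModule.nontrivial (MonoidAlgebra F N) ρV.asModule
    exact Module.finrank_pos
  have hPV0 : 0 < Module.finrank F PV :=
    hV0.trans_le (LinearMap.finrank_le_finrank_of_surjective (f := πV.toLinearMap) hπV.surjective)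
  refine ⟨⟨a, ha⟩, fun b hb => ?_⟩
  -- Comparing dimensions determines the multiplicity, since P_V is nonzero.
  have hba : b = a := by
    have h := (hb.some.toLinearEquiv.symm.trans ha.some.toLinearEquiv).finrank_eq
    rw [CliffordCover.finrank_conjSum, CliffordCover.finrank_conjSum] at h
    exact Nat.eq_of_mul_eq_mul_right (Nat.mul_pos hcard hPV0) h
  subst hba
  have hEfin : Module.Finite F E := .of_surjective π.toLinearMap hπ.surjective
  have hrE := he.some.toLinearEquiv.finrank_eq
  have hrM := φ.toLinearEquiv.finrank_eq
  rw [CliffordCover.finrank_conjSum] at hrE hrM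
  have hpos : 0 < Nat.card (G ⧸ CliffordCover.inertia ρV) * Module.finrank F V :=
    Nat.mul_pos hcard hV0
  constructor
  · have h := LinearMap.finrank_le_finrank_of_surjective (f := ψ.toLinearMap) hψ
    rw [hrE, hrM] at h
    exact Nat.le_of_mul_le_mul_right h hpos
  constructor
  · rintro rfl
    -- Equal multiplicities give equal dimensions, so the surjection `ψ` is bijective and ker π lies
    -- in the radical.
    have hinj : Function.Injective ψ :=
      (LinearMap.injective_iff_surjective_of_finrank_eq_finrank (f := ψ.toLinearMap)
        (hrM.trans hrE.symm)).2 hψ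
    refine CliffordCover.isRelProjective_of_ker_le hπ fun x hx => ?_
    refine (CliffordCover.toHeadRes_eq_zero_iff ρP x).1 (hinj ?_)
    rw [map_zero]
    exact hx
  · intro hrel
    have hinj := hrel.injective ψ hψ hψsup
    have h := (LinearEquiv.ofBijective ψ.toLinearMap ⟨hinj, hψ⟩).finrank_eq
    rw [hrE, hrM] at h
    exact Nat.eq_of_mul_eq_mul_right hpos h
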